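/- Let $\mathcal D$ be a (locally small) category equipped with a proper factorisation system $(\mathcal Q,\mathcal M)$, that is, a weak factorisation system such that every $\mathcal Q$-morphism is an epimorphism and every $\mathcal M$-morphism is a monomorphism; $\mathcal M$-morphisms are called embeddings. Let $\mathcal C$ be a full subcategory of $\mathcal D$ such that: (i) $\mathcal C$ is dense in $\mathcal D$, i.e. every $a\in\mathcal D$ is the colimit of the canonical diagram $\mathcal C\downarrow a\to\mathcal D$; (ii) $\mathcal C$ has all finite colimits, and the inclusion $\mathcal C\hookrightarrow\mathcal D$ preserves them; (iii) for all composable $e\colon x\to y$ in $\mathcal Q$ and $m\colon y\to z$ in $\mathcal M$, if $x,z\in\mathcal C$ then $y\in\mathcal C$. Say that an object $a\in\mathcal D$ is of finite $\mathcal C$-type if the set $\hom_{\mathcal D}(c,a)$ is finite for every $c\in\mathcal C$. Say that $a$ is $\mathcal C$-separable if it is the colimit in $\mathcal D$ of a directed diagram $J$ in $\mathcal C$ (a functor from a nonempty directed preordered set to $\mathcal C$) such that the colimit cocone consists of embeddings and, for every cocone of embeddings over $J$, the unique connecting morphism out of $a$ is also an embedding. Then, for any two $\mathcal C$-separable objects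 $a,b\in\mathcal D$ of finite $\mathcal C$-type, $$a\cong b \iff \hom_{\mathcal D}(c,a)\cong\hom_{\mathcal D}(c,b)\ \text{ (as sets) for all } c\in\mathcal C.$$ -/

import Mathlib

open CategoryTheory Limits

universe w v u

/-- A proper factorisation system `(Q, M)`: a weak factorisation system such that every morphism
in `Q` (a "quotient") is an epimorphism and every morphism in `M` (an "embedding") is a
monomorphism. -/
structure IsProperFactorisationSystem {D : Type u} [Category.{v} D]
    (Q M : MorphismProperty D) : Prop where
  isWeakFactorizationSystem : MorphismProperty.IsWeakFactorizationSystem Q M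
  epi_of_quotient : ∀ {x y : D} (f : x ⟶ y), Q f → Epi f
  mono_of_embedding : ∀ {x y : D} (f : x ⟶ y), M f → Mono f

/-- An object `a` is of finite `C`-type if `hom(c, a)` is finite for every `c` in `C`. -/
def IsOfFiniteType {D : Type u} [Category.{v} D] (C : ObjectProperty D) (a : D) : Prop :=
  ∀ c : D, C c → Finite (c ⟶ a)

/-- An object `a` is `C`-separable (with respect to the class `M` of embeddings) if it is the
colimit of a directed diagram `J` in the full subcategory `C` such that the colimit cocone
consists of embeddings and, for every cocone of embeddings over `J`, the unique connecting
morphism out of `a` is an embedding. The colimit is taken in the ambient category `D`. -/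
def IsSeparableObject {D : Type u} [Category.{v} D] (C : ObjectProperty D)
    (M : MorphismProperty D) (a : D) : Prop :=
  ∃ (I : Type w) (_ : Preorder I) (_ : IsDirectedOrder I) (_ : Nonempty I)
    (J : I ⥤ C.FullSubcategory)
    (κ : J ⋙ C.ι ⟶ (Functor.const I).obj a)
    (hκ : IsColimit (Cocone.mk a κ)),
    (∀ i : I, M (κ.app i)) ∧
      ∀ s : Cocone (J ⋙ C.ι), (∀ i : I, M (s.ι.app i)) → M (hκ.desc s)

/-!
The isomorphism is found by a compactness argument carried by three facts: the inclusion
`F : C ⥤ D` is dense, it preserves the finite colimits of `C`, and the sets `F c ⟶ a` and `F c ⟶ b`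
are finite.

Say that `y : F c ⟶ b` has the same kernel as `x : F c ⟶ a` if `x` and `y` equalise the same
parallel pairs `d ⇉ c` in `C`. Equalising finitely many given pairs amounts to factoring through an
iterated coequaliser `c ⟶ c'` in `C`, an epimorphism that `F` preserves, so the morphisms `F c ⟶ a`
that do so are counted by `F c' ⟶ a`, and there are as many of them as for `b`
(`natCard_equalising_eq`). By inclusion-exclusion the same holds for the morphisms equalising
exactly prescribed members of a finite set of pairs, and since `F c ⟶ b` is finite, every
`x : F c ⟶ a` has a `y : F c ⟶ b` with the same kernel (`exists_forall_iff_of_natCard_eq`,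
`exists_sameKernel`).

Having the same kernel is stable under precomposition with morphisms of `C`, so the nonempty finite
sets of such `y` form a diagram on the opposite of the filtered category `F ↓ a`. It has a
compatible family (`exists_compatible_sameKernel`), that is, a cocone on the canonical diagram of
`a`, and by density a morphism `h : a ⟶ b`. The coproduct `c ⨿ c` in `C` codes two morphisms
`F c ⟶ a` as one, so preservation of kernels makes `h ∘ -` injective on `F c ⟶ a`
(`exists_hom_injective_comp`). These finite sets have the same cardinality, hence `h ∘ -` is
bijective, and density makes `h` an isomorphism (`isIso_of_bijective_comp`).
-/

/-! ### Inclusion-exclusion for families of predicates -/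

lemma natCard_and_not_split {ι X : Type*} [Finite X] [DecidableEq ι] (S : ι → X → Prop)
    (s t : Finset ι) (j : ι) :
    Nat.card {x : X // (∀ i ∈ s, S i x) ∧ ∀ i ∈ t, ¬ S i x} =
      Nat.card {x : X // (∀ i ∈ insert j s, S i x) ∧ ∀ i ∈ t, ¬ S i x} +
      Nat.card {x : X // (∀ i ∈ s, S i x) ∧ ∀ i ∈ insert j t, ¬ S i x} := by
  classical
  have := Fintype.ofFinite X
  simp only [Nat.card_eq_fintype_card, Fintype.card_subtype]
  rw [← Finset.card_filter_add_card_filter_not (s := Finset.univ.filter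
    fun x => (∀ i ∈ s, S i x) ∧ ∀ i ∈ t, ¬ S i x) (S j), Finset.filter_filter,
    Finset.filter_filter]
  congr 2 <;> ext x <;>
    simp only [Finset.mem_filter, Finset.mem_univ, true_and, Finset.forall_mem_insert] <;>
    tauto

/-- If every finite conjunction of predicates `P i` is satisfied by as many elements as the
corresponding conjunction of predicates `R i`, then so is every finite conjunction of such
predicates and negations of such predicates. -/
lemma natCard_and_not_eq_of_natCard_eq {ι A B : Type*} [Finite A] [Finite B]
    (P : ι → A → Prop) (R : ι → B → Prop)
    (h : ∀ s : Finset ι,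
      Nat.card {x : A // ∀ i ∈ s, P i x} = Nat.card {y : B // ∀ i ∈ s, R i y})
    (t s : Finset ι) :
    Nat.card {x : A // (∀ i ∈ s, P i x) ∧ ∀ i ∈ t, ¬ P i x} =
      Nat.card {y : B // (∀ i ∈ s, R i y) ∧ ∀ i ∈ t, ¬ R i y} := by
  classical
  induction t using Finset.induction_on generalizing s with
  | empty => simpa using h s
  | insert j t _ ih =>
    have hA := natCard_and_not_split P s t j
    have hB := natCard_and_not_split R s t j
    have h₁ := ih s
    have h₂ := ih (insert j s)
    omega

/-- If finite conjunctions of the predicates `P i` on `A` and of the predicates `R i` on `B` are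
satisfied equally often, then every complete type realised in `A` is realised in `B`. The index
type may be infinite. -/
lemma exists_forall_iff_of_natCard_eq {ι A B : Type*} [Finite A] [Finite B]
    (P : ι → A → Prop) (R : ι → B → Prop)
    (h : ∀ s : Finset ι,
      Nat.card {x : A // ∀ i ∈ s, P i x} = Nat.card {y : B // ∀ i ∈ s, R i y})
    (x : A) : ∃ y : B, ∀ i, P i x ↔ R i y := by
  classical
  by_contra! H
  choose i hi using H
  have := Fintype.ofFinite B
  -- One index for each element of `B`, telling it apart from `x`, is enough for a contradiction.
  let r : Finset ι := Finset.univ.image i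
  have hcard := natCard_and_not_eq_of_natCard_eq P R h
    (r.filter fun k => ¬ P k x) (r.filter fun k => P k x)
  have hpos : 0 < Nat.card {x' : A // (∀ k ∈ r.filter (fun k => P k x), P k x') ∧
      ∀ k ∈ r.filter (fun k => ¬ P k x), ¬ P k x'} := by
    have : Nonempty {x' : A // (∀ k ∈ r.filter (fun k => P k x), P k x') ∧
        ∀ k ∈ r.filter (fun k => ¬ P k x), ¬ P k x'} :=
      ⟨x, fun k hk => (Finset.mem_filter.1 hk).2, fun k hk => (Finset.mem_filter.1 hk).2⟩
    exact Nat.card_pos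
  rw [hcard] at hpos
  obtain ⟨⟨y, hy₁, hy₂⟩⟩ := (Nat.card_pos_iff.1 hpos).1
  have hir : i y ∈ r := Finset.mem_image_of_mem i (Finset.mem_univ y)
  rcases hi y with ⟨hP, hR⟩ | ⟨hP, hR⟩
  · exact hR (hy₁ _ (Finset.mem_filter.2 ⟨hir, hP⟩))
  · exact hy₂ _ (Finset.mem_filter.2 ⟨hir, hP⟩) hR

section Dense

universe v₁ u₁

variable {K : Type u₁} [Category.{v₁} K] {D : Type u} [Category.{v} D] (F : K ⥤ D)

/-! ### Morphisms with the same kernel -/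

/-- The parallel pairs of morphisms with target `c`. -/
abbrev PairsTo (c : K) : Type (max u₁ v₁) := Σ d : K, (d ⟶ c) × (d ⟶ c)

/-- The morphism `x : F c ⟶ a` equalises the image under `F` of the parallel pair `p`. -/
def Equalises {c : K} {a : D} (p : PairsTo c) (x : F.obj c ⟶ a) : Prop :=
  F.map p.2.1 ≫ x = F.map p.2.2 ≫ x

/-- The morphisms `x` and `y` out of `F c` equalise the same parallel pairs coming from `K`. -/
def SameKernel {c : K} {a b : D} (x : F.obj c ⟶ a) (y : F.obj c ⟶ b) : Prop :=
  ∀ p : PairsTo c, Equalises F p x ↔ Equalises F p y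

lemma SameKernel.precomp {c c' : K} {a b : D} {x : F.obj c ⟶ a} {y : F.obj c ⟶ b}
    (h : SameKernel F x y) (t : c' ⟶ c) : SameKernel F (F.map t ≫ x) (F.map t ≫ y) := by
  intro p
  simpa [Equalises] using h ⟨p.1, p.2.1 ≫ t, p.2.2 ≫ t⟩

/-- Equalising finitely many parallel pairs means factoring through a single epimorphism, their
joint coequaliser. -/
lemma exists_epi_factors_iff_equalises [HasFiniteColimits K] [PreservesFiniteColimits F]
    {c : K} (s : Finset (PairsTo c)) :
    ∃ (c' : K) (e : c ⟶ c'), Epi (F.map e) ∧ ∀ (a : D) (x : F.obj c ⟶ a),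
      (∀ p ∈ s, Equalises F p x) ↔ ∃ z : F.obj c' ⟶ a, F.map e ≫ z = x := by
  classical
  induction s using Finset.induction_on with
  | empty => exact ⟨c, 𝟙 c, inferInstance, fun a x => by simp⟩
  | insert p s _ ih =>
    obtain ⟨c', e, he, H⟩ := ih
    let f := p.2.1 ≫ e
    let g := p.2.2 ≫ e
    have : Epi (F.map (coequalizer.π f g)) := inferInstance
    refine ⟨coequalizer f g, e ≫ coequalizer.π f g, ?_, fun a x => ?_⟩
    · rw [F.map_comp]
      exact epi_comp _ _
    · rw [Finset.forall_mem_insert, H a x]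
      constructor
      · rintro ⟨hp, z, rfl⟩
        have hz : F.map f ≫ z = F.map g ≫ z := by
          simpa [Equalises, f, g] using hp
        refine ⟨(isColimitOfHasCoequalizerOfPreservesColimit F f g).desc (Cofork.ofπ z hz), ?_⟩
        have := (isColimitOfHasCoequalizerOfPreservesColimit F f g).fac (Cofork.ofπ z hz)
          WalkingParallelPair.one
        rw [F.map_comp, Category.assoc]
        congr 1
      · rintro ⟨z, rfl⟩
        refine ⟨?_, F.map (coequalizer.π f g) ≫ z, by simp⟩
        have hfg : p.2.1 ≫ e ≫ coequalizer.π f g = p.2.2 ≫ e ≫ coequalizer.π f g := by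
          simpa [f, g] using coequalizer.condition f g
        rw [Equalises, ← Category.assoc, ← Category.assoc, ← F.map_comp, ← F.map_comp, hfg]

lemma natCard_equalising_eq [HasFiniteColimits K] [PreservesFiniteColimits F] {a b : D}
    (hab : ∀ c : K, Nonempty ((F.obj c ⟶ a) ≃ (F.obj c ⟶ b))) {c : K}
    (s : Finset (PairsTo c)) :
    Nat.card {x : F.obj c ⟶ a // ∀ p ∈ s, Equalises F p x} =
      Nat.card {y : F.obj c ⟶ b // ∀ p ∈ s, Equalises F p y} := by
  obtain ⟨c', e, he, H⟩ := exists_epi_factors_iff_equalises F s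
  have key (d : D) :
      Nat.card {x : F.obj c ⟶ d // ∀ p ∈ s, Equalises F p x} = Nat.card (F.obj c' ⟶ d) := by
    refine (Nat.card_eq_of_bijective
      (fun z : F.obj c' ⟶ d => ⟨F.map e ≫ z, (H d _).2 ⟨z, rfl⟩⟩) ⟨?_, ?_⟩).symm
    · intro z z' hz
      exact (cancel_epi (F.map e)).1 (congrArg Subtype.val hz)
    · rintro ⟨x, hx⟩
      obtain ⟨z, hz⟩ := (H d x).1 hx
      exact ⟨z, Subtype.ext hz⟩
  rw [key a, key b]
  exact Nat.card_congr (hab c').some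

lemma exists_sameKernel [HasFiniteColimits K] [PreservesFiniteColimits F] {a b : D}
    (ha : ∀ c : K, Finite (F.obj c ⟶ a)) (hb : ∀ c : K, Finite (F.obj c ⟶ b))
    (hab : ∀ c : K, Nonempty ((F.obj c ⟶ a) ≃ (F.obj c ⟶ b))) {c : K} (x : F.obj c ⟶ a) :
    ∃ y : F.obj c ⟶ b, SameKernel F x y :=
  have := ha c
  have := hb c
  exists_forall_iff_of_natCard_eq (Equalises F) (Equalises F) (natCard_equalising_eq F hab) x

/-! ### Compactness -/

/-- The presheaf on the comma category `F ↓ a` whose value at `x : F c ⟶ a` is the set of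
morphisms `F c ⟶ b` with the same kernel as `x`. -/
def sameKernelPresheaf (a b : D) : (CostructuredArrow F a)ᵒᵖ ⥤ Type v where
  obj j := {y : F.obj j.unop.left ⟶ b // SameKernel F j.unop.hom y}
  map {j k} t := ↾fun y => ⟨F.map t.unop.left ≫ y.1, by
    rw [← CostructuredArrow.w t.unop]
    exact y.2.precomp F t.unop.left⟩
  map_id j := by
    ext y
    change F.map (𝟙 _) ≫ y.1 = y.1
    rw [F.map_id, Category.id_comp]
  map_comp t t' := by
    ext y
    change F.map (t'.unop.left ≫ t.unop.left) ≫ y.1 = F.map t'.unop.left ≫ F.map t.unop.left ≫ y.1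
    rw [F.map_comp, Category.assoc]

lemma exists_compatible_sameKernel [HasFiniteColimits K] [PreservesFiniteColimits F] {a b : D}
    (ha : ∀ c : K, Finite (F.obj c ⟶ a)) (hb : ∀ c : K, Finite (F.obj c ⟶ b))
    (hab : ∀ c : K, Nonempty ((F.obj c ⟶ a) ≃ (F.obj c ⟶ b))) :
    ∃ y : ∀ j : CostructuredArrow F a, F.obj j.left ⟶ b,
      (∀ j, SameKernel F j.hom (y j)) ∧
        ∀ {j k : CostructuredArrow F a} (t : j ⟶ k), F.map t.left ≫ y k = y j := by
  have := coflat_of_preservesFiniteColimits F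
  have : ∀ j, Finite ((sameKernelPresheaf F a b).obj j) := fun j =>
    have := hb j.unop.left
    Subtype.finite
  have : ∀ j, Nonempty ((sameKernelPresheaf F a b).obj j) := fun j =>
    let ⟨y, hy⟩ := exists_sameKernel F ha hb hab j.unop.hom
    ⟨⟨y, hy⟩⟩
  obtain ⟨y, hy⟩ := nonempty_sections_of_finite_cofiltered_system (sameKernelPresheaf F a b)
  exact ⟨fun j => (y (Opposite.op j)).1, fun j => (y (Opposite.op j)).2,
    fun t => congrArg Subtype.val (hy t.op)⟩

/-! ### Density -/

lemma exists_hom_of_isDense [F.IsDense] {a b : D}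
    (y : ∀ j : CostructuredArrow F a, F.obj j.left ⟶ b)
    (hy : ∀ {j k : CostructuredArrow F a} (t : j ⟶ k), F.map t.left ≫ y k = y j) :
    ∃ h : a ⟶ b, ∀ {c : K} (x : F.obj c ⟶ a), x ≫ h = y (CostructuredArrow.mk x) := by
  let s : Cocone (CostructuredArrow.proj F a ⋙ F) :=
    { pt := b
      ι := { app := y, naturality := fun _ _ t => (hy t).trans (Category.comp_id _).symm } }
  refine ⟨(F.denseAt a).desc s, fun x => Eq.trans ?_ ((F.denseAt a).fac s (.mk x))⟩
  exact congrArg (· ≫ (F.denseAt a).desc s) (Category.id_comp x).symm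

lemma hom_ext_of_isDense [F.IsDense] {a b : D} {f g : a ⟶ b}
    (h : ∀ {c : K} (x : F.obj c ⟶ a), x ≫ f = x ≫ g) : f = g :=
  (F.denseAt a).hom_ext' fun c x => by
    have hx : (𝟙 (F.obj c) ≫ x) ≫ f = (𝟙 (F.obj c) ≫ x) ≫ g := by
      rw [Category.id_comp, h x]
    simpa only [Category.assoc] using! hx

/-- A compatible family of morphisms with the same kernels induces a morphism `a ⟶ b` that is
injective on generalised elements of shape `F c`. -/
lemma exists_hom_injective_comp [F.IsDense] [HasFiniteColimits K] [PreservesFiniteColimits F]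
    {a b : D} (ha : ∀ c : K, Finite (F.obj c ⟶ a)) (hb : ∀ c : K, Finite (F.obj c ⟶ b))
    (hab : ∀ c : K, Nonempty ((F.obj c ⟶ a) ≃ (F.obj c ⟶ b))) :
    ∃ h : a ⟶ b, ∀ c : K, Function.Injective fun x : F.obj c ⟶ a => x ≫ h := by
  obtain ⟨y, hker, hy⟩ := exists_compatible_sameKernel F ha hb hab
  obtain ⟨h, hfac⟩ := exists_hom_of_isDense F y hy
  refine ⟨h, fun c x₁ x₂ hx => ?_⟩
  -- `x` is the copairing of `x₁` and `x₂`, and `F` turns `c ⨿ c` into a coproduct.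
  let hcop := isColimitOfHasBinaryCoproductOfPreservesColimit F c c
  let x : F.obj (c ⨿ c) ⟶ a := hcop.desc (BinaryCofan.mk x₁ x₂)
  have hl : F.map coprod.inl ≫ x = x₁ := hcop.fac (BinaryCofan.mk x₁ x₂) ⟨WalkingPair.left⟩
  have hr : F.map coprod.inr ≫ x = x₂ := hcop.fac (BinaryCofan.mk x₁ x₂) ⟨WalkingPair.right⟩
  have hx' : F.map coprod.inl ≫ x = F.map coprod.inr ≫ x := by
    refine (hker (CostructuredArrow.mk x) ⟨c, coprod.inl, coprod.inr⟩).2 ?_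
    change F.map coprod.inl ≫ y (CostructuredArrow.mk x) =
      F.map coprod.inr ≫ y (CostructuredArrow.mk x)
    rw [← hfac, ← Category.assoc, ← Category.assoc, hl, hr]
    exact hx
  rwa [hl, hr] at hx'

lemma isIso_of_bijective_comp [F.IsDense] {a b : D} (h : a ⟶ b)
    (hbij : ∀ c : K, Function.Bijective fun x : F.obj c ⟶ a => x ≫ h) : IsIso h := by
  choose g hg using fun c => (hbij c).2
  obtain ⟨k, hk⟩ := exists_hom_of_isDense F (a := b) (b := a) (fun j => g j.left j.hom)
    fun {j k} t => (hbij j.left).1 <| by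
      change (F.map t.left ≫ g k.left k.hom) ≫ h = g j.left j.hom ≫ h
      rw [Category.assoc]
      exact (congrArg (F.map t.left ≫ ·) (hg k.left k.hom)).trans
        ((CostructuredArrow.w t).trans (hg j.left j.hom).symm)
  have hkh : k ≫ h = 𝟙 b := hom_ext_of_isDense F fun x => by
    rw [← Category.assoc, hk, Category.comp_id]
    exact hg _ x
  refine ⟨k, hom_ext_of_isDense F fun {c} x => (hbij c).1 ?_, hkh⟩
  simp [hkh]

/-- Let `F` be a dense functor that preserves finite colimits, on a category that has them. Objects
that receive finitely many morphisms from each `F c` are isomorphic as soon as they receive equally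
many. -/
theorem nonempty_iso_of_isDense [F.IsDense] [HasFiniteColimits K] [PreservesFiniteColimits F]
    {a b : D} (ha : ∀ c : K, Finite (F.obj c ⟶ a)) (hb : ∀ c : K, Finite (F.obj c ⟶ b))
    (hab : ∀ c : K, Nonempty ((F.obj c ⟶ a) ≃ (F.obj c ⟶ b))) : Nonempty (a ≅ b) := by
  obtain ⟨h, hinj⟩ := exists_hom_injective_comp F ha hb hab
  have : IsIso h := isIso_of_bijective_comp F h fun c =>
    have := ha c
    have := hb c
    (Nat.bijective_iff_injective_and_card _).2 ⟨hinj c, Nat.card_congr (hab c).some⟩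
  exact ⟨asIso h⟩

end Dense

theorem mainTheorem2 {D : Type u} [Category.{v} D]
    (Q M : MorphismProperty D) (hQM : IsProperFactorisationSystem Q M)
    (C : ObjectProperty D)
    (hdense : C.ι.IsDense)
    (hcolim : HasFiniteColimits C.FullSubcategory)
    (hpres : PreservesFiniteColimits C.ι)
    (hfact : ∀ {x y z : D} (e : x ⟶ y) (m : y ⟶ z), Q e → M m → C x → C z → C y)
    (a b : D)
    (ha : IsSeparableObject.{w} C M a) (hb : IsSeparableObject.{w} C M b)
    (ha' : IsOfFiniteType C a) (hb' : IsOfFiniteType C b) :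
    Nonempty (a ≅ b) ↔ ∀ c : D, C c → Nonempty ((c ⟶ a) ≃ (c ⟶ b)) := by
  refine ⟨fun ⟨i⟩ c _ => ⟨i.homToEquiv⟩, fun h => ?_⟩
  exact nonempty_iso_of_isDense C.ι (fun c => ha' c.obj c.property) (fun c => hb' c.obj c.property)
    fun c => h c.obj c.property
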